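/- A real $r$ is left-c.e. if $\{q\in\mathbb Q : q<r\}$ is computably enumerable. A \emph{left-c.e. metric space} is a complete separable metric space $(M,d)$ with a designated dense sequence $(p_k)_{k\in\mathbb N}$ of special points (repetitions allowed) such that $d(p_i,p_k)$ is a left-c.e. real uniformly in $i,k$. A \emph{Cauchy name} for $x\in M$ is a function $g:\mathbb N\to\mathbb N$ with $d(p_{g(i)},p_{g(k)})\le 2^{-i}$ for all $i\le k$ and $\lim_i p_{g(i)}=x$. An isometric embedding $e:M\to N$ between left-c.e. metric spaces, where $M$ has special points $(p_k)$, is \emph{computable} if, uniformly in $k$, one can compute a Cauchy name for $e(p_k)$ in $N$. For equivalence relations $E,F$ on $\mathbb N$, $E$ is computably reducible to $F$ if there is a computable $f:\mathbb N\to\mathbb N$ with $E(i,k)\Leftrightarrow F(f(i),f(k))$ for all $i,k$. \textbf{Theorem (Gavruskin--Nies).} (1) For each left-c.e. real $\gamma>0$ there is a left-c.e. metric space $U$ of diameter at most $\gamma$ that is universal in the class of left-c.e. metric spaces of diameter at most $\gamma$: every left-c.e. metric space of diameter at most $\gamma$ has a computable isometric embedding into $U$. (2) For $\gamma=1$, such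 a universal space $U$, with special points $(u_k)$, can be chosen so that $\{\langle i,k\rangle : d_U(u_i,u_k)=0\}$ is a universal $\Pi^0_1$ equivalence relation: it is a $\Pi^0_1$ equivalence relation on $\mathbb N$, and every $\Pi^0_1$ equivalence relation on $\mathbb N$ is computably reducible to it. -/

import Mathlib

universe u v

namespace LeftCE

/-- A coding of the rationals by triples of natural numbers: every rational is of the form
`(a - b) / (c + 1)`. -/
def codedRat (t : ℕ × ℕ × ℕ) : ℚ :=
  ((t.1 : ℚ) - (t.2.1 : ℚ)) / ((t.2.2 : ℚ) + 1)

/-- A real is left-c.e. if the set of rationals below it is computably enumerable. -/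
def IsLeftCE (r : ℝ) : Prop :=
  REPred fun t : ℕ × ℕ × ℕ => ((codedRat t : ℚ) : ℝ) < r

/-- A doubly indexed family of reals is left-c.e. uniformly in the indices: the left cuts are
computably enumerable, uniformly in `i` and `k`. -/
def UniformlyLeftCE (r : ℕ → ℕ → ℝ) : Prop :=
  REPred fun x : (ℕ × ℕ) × (ℕ × ℕ × ℕ) => ((codedRat x.2 : ℚ) : ℝ) < r x.1.1 x.1.2

/-- A left-c.e. metric space: a Polish metric space `(M, d)` (complete and separable) with a
designated dense sequence `p` of special points (repetitions allowed), such that `d (p i) (p k)`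
is a left-c.e. real uniformly in `i` and `k`. -/
structure MetricSp where
  /-- the underlying set -/
  carrier : Type u
  [metric : MetricSpace carrier]
  [complete : CompleteSpace carrier]
  /-- the special points -/
  point : ℕ → carrier
  dense : DenseRange point
  leftCE : UniformlyLeftCE fun i k => dist (point i) (point k)

attribute [instance] MetricSp.metric MetricSp.complete

/-- The space has diameter at most `γ`. -/
def MetricSp.DiamLE (M : MetricSp.{u}) (γ : ℝ) : Prop :=
  ∀ x y : M.carrier, dist x y ≤ γ

/-- `g` is a Cauchy name for the point `x` of `M`: `d (p (g i)) (p (g k)) ≤ 2 ^ (-i)` for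
`i ≤ k`, and the sequence `p (g i)` converges to `x`. -/
def MetricSp.IsCauchyName (M : MetricSp.{u}) (g : ℕ → ℕ) (x : M.carrier) : Prop :=
  (∀ i k, i ≤ k → dist (M.point (g i)) (M.point (g k)) ≤ ((2 : ℝ) ^ i)⁻¹) ∧
    Filter.Tendsto (fun i => M.point (g i)) Filter.atTop (nhds x)

/-- `e` is a computable isometric embedding: an isometry such that, uniformly in `k`, one can
compute a Cauchy name for the image of the `k`-th special point. -/
def IsComputableEmbedding (M : MetricSp.{u}) (N : MetricSp.{v})
    (e : M.carrier → N.carrier) : Prop :=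
  Isometry e ∧
    ∃ c : ℕ → ℕ → ℕ, Computable₂ c ∧ ∀ k, N.IsCauchyName (c k) (e (M.point k))

/-- `U` is universal, with respect to computable isometric embeddings, within the class of left-c.e.
metric spaces of diameter at most `γ`: it belongs to the class, and each member of the class has
a computable isometric embedding into it. -/
def IsUniversalSpace (γ : ℝ) (U : MetricSp.{v}) : Prop :=
  U.DiamLE γ ∧
    ∀ M : MetricSp.{u}, M.DiamLE γ →
      ∃ e : M.carrier → U.carrier, IsComputableEmbedding M U e

/-- `E` is a `Π⁰₁` equivalence relation on the natural numbers. -/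
def IsPi01Equivalence (E : ℕ → ℕ → Prop) : Prop :=
  Equivalence E ∧ REPred fun x : ℕ × ℕ => ¬ E x.1 x.2

/-- Computable reducibility of equivalence relations on the natural numbers. -/
def ComputablyReducible (E F : ℕ → ℕ → Prop) : Prop :=
  ∃ f : ℕ → ℕ, Computable f ∧ ∀ i k, E i k ↔ F (f i) (f k)

/-- `E` is a universal `Π⁰₁` equivalence relation under computable reducibility. -/
def IsUniversalPi01Equivalence (E : ℕ → ℕ → Prop) : Prop :=
  IsPi01Equivalence E ∧ ∀ F : ℕ → ℕ → Prop, IsPi01Equivalence F → ComputablyReducible F E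

end LeftCE

namespace LeftCE

/-! ### Computability preliminaries -/

/-! The left-c.e. pseudometrics on the natural numbers bounded by `γ` can be listed effectively, and
the universal space is the completion of their disjoint union, with distance `γ` between different
members of the list.

The list rests on a normal form. A left-c.e. pseudometric is the pointwise supremum of a computable
increasing sequence of rational pseudometrics, the `n`-th living on `{i | i < n}`
(`NatPseudoMetric.exists_approximation`). The next matrix is found by unbounded search. The search
succeeds because below any pseudometric there are rational ones lying above any prescribed strictly
smaller values (`exists_ratMatrix_between`).

Conversely, an arbitrary program is trusted only as far as its outputs have been checked to form
such a sequence. Its component carries the supremum of the checked matrices, capped at `γ`. A number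
whose existence as a point is never confirmed is identified with the point `0`, which secures the
triangle inequality (`componentDist_triangle`). A program computing the normal form of a given
pseudometric bounded by `γ` yields exactly that pseudometric
(`NatPseudoMetric.exists_universalDist_eq`), and the embedding extends to completions.

For `γ = 1`, a `Π⁰₁` equivalence relation is the zero-distance relation of a left-c.e. `{0,
1}`-valued pseudometric, so embedding that pseudometric is a reduction. -/

theorem primrecPred_forall_lt {α : Type*} [Primcodable α] {p : α × ℕ → Prop} {f : α → ℕ}
    (hp : PrimrecPred p) (hf : Primrec f) : PrimrecPred fun a => ∀ x < f a, p (a, x) :=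
  ((PrimrecRel.forall_mem_list (R := fun (x : ℕ) (a : α) => p (a, x))
    (hp.comp (Primrec.snd.pair Primrec.fst))).comp (Primrec.list_range.comp hf) Primrec.id).of_eq
    fun a => by simp

theorem rePred_and {α : Type*} [Primcodable α] {p q : α → Prop} (hp : REPred p)
    (hq : REPred q) : REPred fun a => p a ∧ q a :=
  (Partrec.dom_re (hp.bind (hq.comp Computable.fst).to₂)).of_eq fun a => by
    simp [Part.assert]

theorem rePred_comp {α β : Type*} [Primcodable α] [Primcodable β] {p : β → Prop} {f : α → β}
    (hp : REPred p) (hf : Computable f) : REPred fun a => p (f a) :=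
  Partrec.comp hp hf

theorem rePred_exists {α β : Type*} [Primcodable α] [Denumerable β] {p : α × β → Prop}
    (hp : PrimrecPred p) : REPred fun a => ∃ b, p (a, b) := by
  classical
  have h : Partrec fun a : α =>
      Nat.rfind fun n => Part.some (decide (p (a, Denumerable.ofNat β n))) :=
    Partrec.rfind (hp.comp (Primrec.fst.pair
      ((Primrec.ofNat β).comp Primrec.snd))).decide.to_comp.partrec
  refine h.dom_re.of_eq fun a => ?_
  refine Nat.rfind_dom.trans ⟨?_, ?_⟩
  · rintro ⟨n, hn, -⟩
    exact ⟨_, by simpa using hn⟩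
  · rintro ⟨b, hb⟩
    exact ⟨Encodable.encode b, by simpa using hb, fun _ => trivial⟩

/-- A computably enumerable predicate is the union of an increasing, uniformly decidable sequence of
predicates. -/
theorem REPred.exists_stages {α : Type*} [Primcodable α] {p : α → Prop} (hp : REPred p) :
    ∃ R : ℕ → α → Prop, PrimrecRel R ∧ (∀ s t a, s ≤ t → R s a → R t a) ∧
      ∀ a, p a ↔ ∃ t, R t a := by
  obtain ⟨c, hc⟩ := Nat.Partrec.Code.exists_code.1 hp
  refine ⟨fun t a => (c.evaln t (Encodable.encode a)).isSome = true, ?_, ?_, ?_⟩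
  · exact Primrec.eq.comp (Primrec.option_isSome.comp (Nat.Partrec.Code.primrec_evaln.comp
      ((Primrec.fst.pair (Primrec.const c)).pair (Primrec.encode.comp Primrec.snd))))
      (Primrec.const true)
  · intro s t a hst h
    obtain ⟨x, hx⟩ := Option.isSome_iff_exists.1 h
    exact Option.isSome_iff_exists.2 ⟨x, Nat.Partrec.Code.evaln_mono hst hx⟩
  · intro a
    have h1 : p a ↔ (c.eval (Encodable.encode a)).Dom := by
      rw [hc]
      simp [Part.assert]
    rw [h1, Part.dom_iff_mem]
    simp only [Nat.Partrec.Code.evaln_complete, Option.isSome_iff_exists]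
    exact exists_comm

/-! ### Finite rational matrices -/

/-- A finite matrix of nonnegative rationals: a denominator and a list of numerators. -/
abbrev RatMatrix : Type := ℕ × List ℕ

/-- The numerator of the entry at `(i, k)`. -/
def RatMatrix.num (D : RatMatrix) (i k : ℕ) : ℕ := D.2.getD (Nat.pair i k) 0

/-- The entry at `(i, k)`. -/
noncomputable def RatMatrix.entry (D : RatMatrix) (i k : ℕ) : ℝ := D.num i k / ((D.1 : ℝ) + 1)

/-- `D` is a pseudometric on `{i | i < n}`. -/
def RatMatrix.IsPseudo (n : ℕ) (D : RatMatrix) : Prop :=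
  ∀ i < n, D.num i i = 0 ∧ ∀ j < n, D.num i j = D.num j i ∧
    ∀ k < n, D.num i k ≤ D.num i j + D.num j k

/-- `D` is pointwise at most `D'` on `{i | i < n}`. -/
def RatMatrix.LE (n : ℕ) (D D' : RatMatrix) : Prop :=
  ∀ i < n, ∀ k < n, D.num i k * (D'.1 + 1) ≤ D'.num i k * (D.1 + 1)

theorem RatMatrix.primrec_num : Primrec fun x : RatMatrix × ℕ × ℕ => x.1.num x.2.1 x.2.2 :=
  (Primrec.list_getD 0).comp (Primrec.snd.comp Primrec.fst)
    (Primrec₂.natPair.comp (Primrec.fst.comp Primrec.snd) (Primrec.snd.comp Primrec.snd))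

theorem RatMatrix.primrec_num_comp {α : Type*} [Primcodable α] {D : α → RatMatrix} {i k : α → ℕ}
    (hD : Primrec D) (hi : Primrec i) (hk : Primrec k) :
    Primrec fun a => (D a).num (i a) (k a) :=
  RatMatrix.primrec_num.comp (hD.pair (hi.pair hk))

theorem RatMatrix.primrec_isPseudo : PrimrecRel RatMatrix.IsPseudo := by
  open Primrec in
  have h1 : PrimrecPred fun x : (((ℕ × RatMatrix) × ℕ) × ℕ) × ℕ =>
      x.1.1.1.2.num x.1.1.2 x.2 ≤ x.1.1.1.2.num x.1.1.2 x.1.2 + x.1.1.1.2.num x.1.2 x.2 :=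
    nat_le.comp
      (primrec_num_comp (snd.comp (fst.comp (fst.comp fst))) (snd.comp (fst.comp fst)) snd)
      (nat_add.comp
        (primrec_num_comp (snd.comp (fst.comp (fst.comp fst))) (snd.comp (fst.comp fst))
          (snd.comp fst))
        (primrec_num_comp (snd.comp (fst.comp (fst.comp fst))) (snd.comp fst) snd))
  have h2 : PrimrecPred fun x : ((ℕ × RatMatrix) × ℕ) × ℕ =>
      x.1.1.2.num x.1.2 x.2 = x.1.1.2.num x.2 x.1.2 :=
    Primrec.eq.comp (primrec_num_comp (snd.comp (fst.comp fst)) (snd.comp fst) snd)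
      (primrec_num_comp (snd.comp (fst.comp fst)) snd (snd.comp fst))
  have h3 : PrimrecPred fun x : (ℕ × RatMatrix) × ℕ => x.1.2.num x.2 x.2 = 0 :=
    Primrec.eq.comp (primrec_num_comp (snd.comp fst) snd snd) (const 0)
  exact primrecPred_forall_lt (h3.and (primrecPred_forall_lt
    (h2.and (primrecPred_forall_lt h1 (fst.comp (fst.comp fst)))) (fst.comp fst))) fst

theorem RatMatrix.primrec_le :
    PrimrecPred fun x : ℕ × RatMatrix × RatMatrix => RatMatrix.LE x.1 x.2.1 x.2.2 := by
  open Primrec in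
  have h1 : PrimrecPred fun x : ((ℕ × RatMatrix × RatMatrix) × ℕ) × ℕ =>
      x.1.1.2.1.num x.1.2 x.2 * (x.1.1.2.2.1 + 1) ≤
        x.1.1.2.2.num x.1.2 x.2 * (x.1.1.2.1.1 + 1) :=
    nat_le.comp
      (nat_mul.comp (primrec_num_comp (fst.comp (snd.comp (fst.comp fst))) (snd.comp fst) snd)
        (succ.comp (fst.comp (snd.comp (snd.comp (fst.comp fst))))))
      (nat_mul.comp (primrec_num_comp (snd.comp (snd.comp (fst.comp fst))) (snd.comp fst) snd)
        (succ.comp (fst.comp (fst.comp (snd.comp (fst.comp fst))))))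
  exact primrecPred_forall_lt (primrecPred_forall_lt h1 (fst.comp fst)) fst

theorem RatMatrix.entry_nonneg (D : RatMatrix) (i k : ℕ) : 0 ≤ D.entry i k := by
  unfold entry; positivity

theorem RatMatrix.IsPseudo.entry_self {n : ℕ} {D : RatMatrix} (hD : D.IsPseudo n) {i : ℕ}
    (hi : i < n) : D.entry i i = 0 := by
  simp [entry, (hD i hi).1]

theorem RatMatrix.IsPseudo.entry_comm {n : ℕ} {D : RatMatrix} (hD : D.IsPseudo n) {i k : ℕ}
    (hi : i < n) (hk : k < n) : D.entry i k = D.entry k i := by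
  simp [entry, ((hD i hi).2 k hk).1]

theorem RatMatrix.IsPseudo.entry_triangle {n : ℕ} {D : RatMatrix} (hD : D.IsPseudo n) {i j k : ℕ}
    (hi : i < n) (hj : j < n) (hk : k < n) : D.entry i k ≤ D.entry i j + D.entry j k := by
  unfold entry
  rw [← add_div]
  gcongr
  exact_mod_cast ((hD i hi).2 j hj).2 k hk

theorem RatMatrix.entry_le_entry_iff {D D' : RatMatrix} {i k : ℕ} :
    D.entry i k ≤ D'.entry i k ↔ D.num i k * (D'.1 + 1) ≤ D'.num i k * (D.1 + 1) := by
  unfold entry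
  rw [div_le_div_iff₀ (by positivity) (by positivity)]
  exact_mod_cast Iff.rfl

theorem RatMatrix.LE.entry_le {n : ℕ} {D D' : RatMatrix} (h : RatMatrix.LE n D D') {i k : ℕ}
    (hi : i < n) (hk : k < n) : D.entry i k ≤ D'.entry i k :=
  entry_le_entry_iff.2 (h i hi k hk)

theorem RatMatrix.codedRat_lt_entry_iff {D : RatMatrix} {i k : ℕ} {q : ℕ × ℕ × ℕ} :
    ((codedRat q : ℚ) : ℝ) < D.entry i k ↔
      q.1 * (D.1 + 1) < D.num i k * (q.2.2 + 1) + q.2.1 * (D.1 + 1) := by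
  unfold entry codedRat
  push_cast
  rw [div_lt_div_iff₀ (by positivity) (by positivity), sub_mul, sub_lt_iff_lt_add]
  exact_mod_cast Iff.rfl

theorem RatMatrix.primrec_codedRat_lt_entry : PrimrecPred
    fun x : (ℕ × ℕ × ℕ) × RatMatrix × ℕ × ℕ =>
      ((codedRat x.1 : ℚ) : ℝ) < x.2.1.entry x.2.2.1 x.2.2.2 := by
  open Primrec in
  have : PrimrecPred fun x : (ℕ × ℕ × ℕ) × RatMatrix × ℕ × ℕ =>
      x.1.1 * (x.2.1.1 + 1) < x.2.1.num x.2.2.1 x.2.2.2 * (x.1.2.2 + 1) + x.1.2.1 * (x.2.1.1 + 1) :=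
    nat_lt.comp
      (nat_mul.comp (fst.comp fst) (succ.comp (fst.comp (fst.comp snd))))
      (nat_add.comp
        (nat_mul.comp (primrec_num.comp snd) (succ.comp (snd.comp (snd.comp fst))))
        (nat_mul.comp (fst.comp (snd.comp fst)) (succ.comp (fst.comp (fst.comp snd)))))
  exact this.of_eq fun x => RatMatrix.codedRat_lt_entry_iff.symm

/-- Every function agrees on `{i | i < n}` with the numerators of some matrix. -/
theorem RatMatrix.exists_num_eq (n N : ℕ) (a : ℕ → ℕ → ℕ) :
    ∃ D : RatMatrix, D.1 = N ∧ ∀ i < n, ∀ k < n, D.num i k = a i k := by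
  refine ⟨(N, (List.range (Nat.pair n n)).map fun z => a z.unpair.1 z.unpair.2), rfl, ?_⟩
  intro i hi k hk
  have : Nat.pair i k < Nat.pair n n :=
    (Nat.pair_lt_pair_left k hi).trans (Nat.pair_lt_pair_right n hk)
  simp [num, List.getD_eq_getElem?_getD, this]

/-- A pseudometric can be approximated from below, arbitrarily well, by rational pseudometrics on
finite sets. -/
theorem exists_ratMatrix_between {h b : ℕ → ℕ → ℝ} (h0 : ∀ i, h i i = 0)
    (hc : ∀ i k, h i k = h k i) (ht : ∀ i j k, h i k ≤ h i j + h j k)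
    (hb : ∀ i k, b i k ≤ 0 ∨ b i k < h i k) (n : ℕ) :
    ∃ D : RatMatrix, D.IsPseudo n ∧
      (∀ i < n, ∀ k < n, D.num i k = 0 ∨ D.entry i k < h i k) ∧
      ∀ i < n, ∀ k < n, b i k ≤ D.entry i k := by
  have hn : ∀ i k, 0 ≤ h i k := fun i k => by
    have := ht i k i
    rw [h0, hc k i] at this
    linarith
  -- Shrinking `h` by a factor close to `1` keeps it above the finitely many strict lower bounds and
  -- leaves room for rounding up.
  obtain ⟨l, hl0, hl1, hl⟩ : ∃ l : ℝ, 0 < l ∧ l < 1 ∧ ∀ i < n, ∀ k < n, b i k ≤ l * h i k := by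
    have h1 : ∀ᶠ l : ℝ in nhdsWithin 1 (Set.Iio 1), ∀ i ∈ Set.Iio n, ∀ k ∈ Set.Iio n,
        0 < l → b i k ≤ l * h i k := by
      rw [Filter.eventually_all_finite (Set.finite_Iio n)]
      intro i _
      rw [Filter.eventually_all_finite (Set.finite_Iio n)]
      intro k _
      rcases hb i k with hb | hb
      · exact Filter.Eventually.of_forall fun l hl => hb.trans (mul_nonneg hl.le (hn i k))
      · have : Filter.Tendsto (fun l : ℝ => l * h i k) (nhdsWithin 1 (Set.Iio 1))
            (nhds (1 * h i k)) :=
          ((continuous_id.mul continuous_const).tendsto 1).mono_left nhdsWithin_le_nhds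
        rw [one_mul] at this
        filter_upwards [this.eventually (lt_mem_nhds hb)] with l hl _ using hl.le
    have h2 : ∀ᶠ l : ℝ in nhdsWithin 1 (Set.Iio 1), 0 < l :=
      nhdsWithin_le_nhds (lt_mem_nhds one_pos)
    have h3 : ∀ᶠ l : ℝ in nhdsWithin 1 (Set.Iio 1), l < 1 := self_mem_nhdsWithin
    obtain ⟨l, h1, h2, h3⟩ := (h1.and (h2.and h3)).exists
    exact ⟨l, h2, h3, fun i hi k hk => h1 i hi k hk h2⟩
  obtain ⟨N, hN⟩ : ∃ N : ℕ, ∀ i < n, ∀ k < n, 0 < h i k →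
      1 / ((N : ℝ) + 1) < (1 - l) * h i k := by
    have : ∀ᶠ N : ℕ in Filter.atTop, ∀ i ∈ Set.Iio n, ∀ k ∈ Set.Iio n, 0 < h i k →
        1 / ((N : ℝ) + 1) < (1 - l) * h i k := by
      rw [Filter.eventually_all_finite (Set.finite_Iio n)]
      intro i _
      rw [Filter.eventually_all_finite (Set.finite_Iio n)]
      intro k _
      by_cases hik : 0 < h i k
      · filter_upwards [tendsto_one_div_add_atTop_nhds_zero_nat.eventually
          (gt_mem_nhds (mul_pos (sub_pos.2 hl1) hik))] with N hN _ using hN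
      · exact Filter.Eventually.of_forall fun _ h => absurd h hik
    exact this.exists
  -- The ceiling is monotone and subadditive, so rounding up preserves the triangle inequality. The
  -- error is below `1 / (N + 1)`, which fits into the gap `(1 - l) * h i k`.
  obtain ⟨D, hDN, hD⟩ := RatMatrix.exists_num_eq n N fun i k => ⌈((N : ℝ) + 1) * (l * h i k)⌉₊
  have hN0 : (0 : ℝ) < (N : ℝ) + 1 := by positivity
  have hp : ∀ i k, 0 ≤ ((N : ℝ) + 1) * (l * h i k) := fun i k =>
    mul_nonneg hN0.le (mul_nonneg hl0.le (hn i k))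
  refine ⟨D, fun i hi => ⟨?_, fun j hj => ⟨?_, fun k hk => ?_⟩⟩, fun i hi k hk => ?_,
    fun i hi k hk => ?_⟩
  · simp [hD i hi i hi, h0]
  · rw [hD i hi j hj, hD j hj i hi, hc]
  · rw [hD i hi j hj, hD j hj k hk, hD i hi k hk]
    refine (Nat.ceil_le_ceil ?_).trans (Nat.ceil_add_le _ _)
    rw [← mul_add, ← mul_add]
    gcongr
    exact ht i j k
  · rcases (hn i k).eq_or_lt with h | h
    · left
      simp [hD i hi k hk, ← h]
    · right
      have h1 := Nat.ceil_lt_add_one (hp i k)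
      have h2 := hN i hi k hk h
      rw [div_lt_iff₀ hN0] at h2
      rw [RatMatrix.entry, hD i hi k hk, hDN, div_lt_iff₀ hN0]
      linarith
  · refine (hl i hi k hk).trans ?_
    rw [RatMatrix.entry, hD i hi k hk, hDN, le_div_iff₀ hN0, mul_comm]
    exact Nat.le_ceil _

/-! ### Spaces from pseudometrics on the natural numbers -/

/-- A pseudometric on the natural numbers. -/
structure NatPseudoMetric where
  /-- the distance -/
  d : ℕ → ℕ → ℝ
  self : ∀ i, d i i = 0
  comm : ∀ i k, d i k = d k i
  triangle : ∀ i j k, d i k ≤ d i j + d j k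

/-- The natural numbers, equipped with the pseudometric `δ`. -/
def NatPseudoMetric.Pt (_δ : NatPseudoMetric) : Type := ℕ

/-- The point `i`. -/
def NatPseudoMetric.pt (δ : NatPseudoMetric) (i : ℕ) : δ.Pt := i

noncomputable instance (δ : NatPseudoMetric) : PseudoMetricSpace δ.Pt where
  dist i k := δ.d i k
  dist_self := δ.self
  dist_comm := δ.comm
  dist_triangle := δ.triangle

/-- The completion of the natural numbers with respect to a left-c.e. pseudometric. -/
noncomputable def NatPseudoMetric.toMetricSp (δ : NatPseudoMetric) (h : UniformlyLeftCE δ.d) :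
    MetricSp.{0} where
  carrier := UniformSpace.Completion δ.Pt
  point i := UniformSpace.Completion.coe' (δ.pt i)
  dense := UniformSpace.Completion.denseRange_coe.comp
    (Function.surjective_id (α := δ.Pt)).denseRange (UniformSpace.Completion.continuous_coe δ.Pt)
  leftCE := by
    have : (fun i k : ℕ => dist (UniformSpace.Completion.coe' (δ.pt i))
        (UniformSpace.Completion.coe' (δ.pt k))) = δ.d := by
      funext i k
      exact UniformSpace.Completion.dist_eq (δ.pt i) (δ.pt k)
    rw [this]
    exact h

theorem NatPseudoMetric.dist_point (δ : NatPseudoMetric) (h : UniformlyLeftCE δ.d) (i k : ℕ) :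
    dist ((δ.toMetricSp h).point i) ((δ.toMetricSp h).point k) = δ.d i k :=
  UniformSpace.Completion.dist_eq (δ.pt i) (δ.pt k)

theorem MetricSp.diamLE_of_point {M : MetricSp.{u}} {γ : ℝ}
    (h : ∀ i k, dist (M.point i) (M.point k) ≤ γ) : M.DiamLE γ := fun x y =>
  M.dense.induction_on₂ (p := fun x y => dist x y ≤ γ)
    (isClosed_le (continuous_fst.dist continuous_snd) continuous_const) h x y

/-- The pseudometric induced by the special points of a space. -/
noncomputable def MetricSp.natPseudoMetric (M : MetricSp.{u}) : NatPseudoMetric where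
  d i k := dist (M.point i) (M.point k)
  self _ := dist_self _
  comm _ _ := dist_comm _ _
  triangle _ _ _ := dist_triangle _ _ _

/-- A computable distance-preserving map of special points extends to a computable isometric
embedding. -/
theorem exists_isComputableEmbedding {M : MetricSp.{u}} {N : MetricSp.{v}} {f : ℕ → ℕ}
    (hf : Computable f)
    (h : ∀ i k, dist (N.point (f i)) (N.point (f k)) = dist (M.point i) (M.point k)) :
    ∃ e : M.carrier → N.carrier, IsComputableEmbedding M N e := by
  -- With the pulled-back pseudometric on the indices, both `p` and `g` are isometries. The
  -- embedding is the extension of `g` along the dense map `p`, and constant sequences serve as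
  -- Cauchy names.
  let p : M.natPseudoMetric.Pt → M.carrier := M.point
  let g : M.natPseudoMetric.Pt → N.carrier := fun i => N.point (f i)
  have hp : Isometry p := Isometry.of_dist_eq fun i k => rfl
  have hg : Isometry g := Isometry.of_dist_eq h
  have hd : DenseRange p := M.dense
  let di := hp.isUniformInducing.isDenseInducing hd
  have huc : UniformContinuous (di.extend g) :=
    uniformContinuous_uniformly_extend hp.isUniformInducing hd hg.uniformContinuous
  have he : ∀ i : M.natPseudoMetric.Pt, di.extend g (p i) = g i := fun i =>
    di.extend_eq hg.continuous i
  refine ⟨di.extend g, Isometry.of_dist_eq fun x y => ?_, fun k _ => f k,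
    (hf.comp Computable.fst).to₂, fun k => ⟨fun i j _ => ?_, ?_⟩⟩
  · refine hd.induction_on₂ (p := fun x y => dist (di.extend g x) (di.extend g y) = dist x y)
      (isClosed_eq ((huc.continuous.comp continuous_fst).dist
        (huc.continuous.comp continuous_snd)) (continuous_fst.dist continuous_snd)) ?_ x y
    intro i k
    rw [he, he]
    exact h i k
  · rw [dist_self]
    positivity
  · rw [show di.extend g (M.point k) = N.point (f k) from he k]
    exact tendsto_const_nhds

/-! ### The component of the universal space given by a program -/

open Nat.Partrec (Code)
open Nat.Partrec.Code (evaln eval)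

/-- The matrix output by the program `c` at input `n` within `s` steps. -/
def stageMatrix (c : Code) (s n : ℕ) : RatMatrix :=
  Denumerable.ofNat RatMatrix ((evaln s c n).getD 0)

/-- Within `s` steps, the program `c` is seen to output an increasing sequence of pseudometrics
on initial segments of the natural numbers, up to input `n`. -/
def Valid (c : Code) (n s : ℕ) : Prop :=
  ∀ m < n, (evaln s c m).isSome = true ∧ (evaln s c (m + 1)).isSome = true ∧
    (stageMatrix c s (m + 1)).IsPseudo (m + 1) ∧
    RatMatrix.LE m (stageMatrix c s m) (stageMatrix c s (m + 1))

theorem primrec_stageMatrix : Primrec fun x : (ℕ × Code) × ℕ => stageMatrix x.1.2 x.1.1 x.2 :=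
  (Primrec.ofNat RatMatrix).comp
    (Primrec.option_getD.comp Nat.Partrec.Code.primrec_evaln (Primrec.const 0))

theorem primrec_valid : PrimrecPred fun x : (Code × ℕ) × ℕ => Valid x.1.1 x.1.2 x.2 := by
  open Primrec in
  have h0 : Primrec fun x : ((Code × ℕ) × ℕ) × ℕ => ((x.1.2, x.1.1.1), x.2) :=
    ((snd.comp fst).pair (fst.comp (fst.comp fst))).pair snd
  have h1 : Primrec fun x : ((Code × ℕ) × ℕ) × ℕ => ((x.1.2, x.1.1.1), x.2 + 1) :=
    ((snd.comp fst).pair (fst.comp (fst.comp fst))).pair (succ.comp snd)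
  have e0 : PrimrecPred fun x : ((Code × ℕ) × ℕ) × ℕ =>
      (evaln x.1.2 x.1.1.1 x.2).isSome = true :=
    Primrec.eq.comp (option_isSome.comp (Nat.Partrec.Code.primrec_evaln.comp h0)) (const true)
  have e1 : PrimrecPred fun x : ((Code × ℕ) × ℕ) × ℕ =>
      (evaln x.1.2 x.1.1.1 (x.2 + 1)).isSome = true :=
    Primrec.eq.comp (option_isSome.comp (Nat.Partrec.Code.primrec_evaln.comp h1)) (const true)
  have e2 : PrimrecPred fun x : ((Code × ℕ) × ℕ) × ℕ =>
      (stageMatrix x.1.1.1 x.1.2 (x.2 + 1)).IsPseudo (x.2 + 1) :=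
    RatMatrix.primrec_isPseudo.comp (succ.comp snd) (primrec_stageMatrix.comp h1)
  have e3 : PrimrecPred fun x : ((Code × ℕ) × ℕ) × ℕ =>
      RatMatrix.LE x.2 (stageMatrix x.1.1.1 x.1.2 x.2) (stageMatrix x.1.1.1 x.1.2 (x.2 + 1)) :=
    RatMatrix.primrec_le.comp
      (snd.pair ((primrec_stageMatrix.comp h0).pair (primrec_stageMatrix.comp h1)))
  exact primrecPred_forall_lt (e0.and (e1.and (e2.and e3))) (snd.comp fst)

theorem stageMatrix_eq {c : Code} {s n x : ℕ} (hx : x ∈ eval c n)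
    (h : (evaln s c n).isSome = true) : stageMatrix c s n = Denumerable.ofNat RatMatrix x := by
  obtain ⟨y, hy⟩ := Option.isSome_iff_exists.1 h
  have := Part.mem_unique (Nat.Partrec.Code.evaln_sound hy) hx
  subst this
  simp [stageMatrix, hy]

theorem stageMatrix_congr {c : Code} {s t n : ℕ} (hs : (evaln s c n).isSome = true)
    (ht : (evaln t c n).isSome = true) : stageMatrix c s n = stageMatrix c t n := by
  obtain ⟨y, hy⟩ := Option.isSome_iff_exists.1 hs
  rw [stageMatrix_eq (Nat.Partrec.Code.evaln_sound hy) hs,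
    stageMatrix_eq (Nat.Partrec.Code.evaln_sound hy) ht]

theorem Valid.isSome {c : Code} {n s : ℕ} (h : Valid c n s) (hn : 0 < n) :
    (evaln s c n).isSome = true := by
  have := (h (n - 1) (by omega)).2.1
  rwa [Nat.sub_add_cancel hn] at this

theorem Valid.isPseudo {c : Code} {n s : ℕ} (h : Valid c n s) (hn : 0 < n) :
    (stageMatrix c s n).IsPseudo n := by
  have := (h (n - 1) (by omega)).2.2.1
  rwa [Nat.sub_add_cancel hn] at this

theorem Valid.entry_le {c : Code} {m n s : ℕ} (h : Valid c n s) (hmn : m ≤ n) {i k : ℕ}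
    (hi : i < m) (hk : k < m) :
    (stageMatrix c s m).entry i k ≤ (stageMatrix c s n).entry i k := by
  induction n, hmn using Nat.le_induction with
  | base => exact le_rfl
  | succ n hmn ih =>
    exact (ih fun j hj => h j (by omega)).trans
      ((h n (by omega)).2.2.2.entry_le (by omega) (by omega))

/-- An output does not depend on the stage at which it is read, so matrices validated at unrelated
stages can be compared. -/
theorem Valid.entry_le_of_le {c : Code} {m n s t : ℕ} (hs : Valid c m s) (ht : Valid c n t)
    (hmn : m ≤ n) {i k : ℕ} (hi : i < m) (hk : k < m) :
    (stageMatrix c s m).entry i k ≤ (stageMatrix c t n).entry i k := by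
  have h : Valid c m t := fun j hj => ht j (by omega)
  rw [stageMatrix_congr (hs.isSome (by omega)) (h.isSome (by omega))]
  exact ht.entry_le hmn hi hk

/-- The contribution of the matrix at `w.1`, as seen at stage `w.2`, to the distance of the points
`i` and `k`. -/
noncomputable def stageDist (γ : ℝ) (c : Code) (i k : ℕ) (w : ℕ × ℕ) : ℝ :=
  open Classical in
  if Valid c w.1 w.2 ∧ i < w.1 ∧ k < w.1 then min γ ((stageMatrix c w.2 w.1).entry i k) else 0

/-- The distance of the points `i` and `k` in the component given by `c`. -/
noncomputable def componentDist (γ : ℝ) (c : Code) (i k : ℕ) : ℝ :=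
  ⨆ w : ℕ × ℕ, stageDist γ c i k w

theorem stageDist_of_valid {γ : ℝ} {c : Code} {i k n s : ℕ} (h : Valid c n s) (hi : i < n)
    (hk : k < n) : stageDist γ c i k (n, s) = min γ ((stageMatrix c s n).entry i k) :=
  if_pos ⟨h, hi, hk⟩

theorem stageDist_nonneg {γ : ℝ} (hγ : 0 ≤ γ) (c : Code) (i k : ℕ) (w : ℕ × ℕ) :
    0 ≤ stageDist γ c i k w := by
  unfold stageDist
  split_ifs
  · exact le_min hγ (RatMatrix.entry_nonneg _ _ _)
  · exact le_rfl

theorem stageDist_le {γ : ℝ} (hγ : 0 ≤ γ) (c : Code) (i k : ℕ) (w : ℕ × ℕ) :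
    stageDist γ c i k w ≤ γ := by
  unfold stageDist
  split_ifs
  · exact min_le_left _ _
  · exact hγ

theorem bddAbove_stageDist {γ : ℝ} (hγ : 0 ≤ γ) (c : Code) (i k : ℕ) :
    BddAbove (Set.range (stageDist γ c i k)) :=
  ⟨γ, by rintro _ ⟨w, rfl⟩; exact stageDist_le hγ c i k w⟩

theorem stageDist_le_componentDist {γ : ℝ} (hγ : 0 ≤ γ) (c : Code) (i k : ℕ) (w : ℕ × ℕ) :
    stageDist γ c i k w ≤ componentDist γ c i k :=
  le_ciSup (bddAbove_stageDist hγ c i k) w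

theorem componentDist_le {γ : ℝ} (hγ : 0 ≤ γ) (c : Code) (i k : ℕ) : componentDist γ c i k ≤ γ :=
  ciSup_le (stageDist_le hγ c i k)

theorem componentDist_nonneg {γ : ℝ} (hγ : 0 ≤ γ) (c : Code) (i k : ℕ) :
    0 ≤ componentDist γ c i k :=
  (stageDist_nonneg hγ c i k 0).trans (stageDist_le_componentDist hγ c i k 0)

/-- The condition `q < γ` is separated out because `γ` is only left-c.e.; for rational `q` the rest
is a search over decidable conditions. The case `q < 0` comes from the default value `0` of
`stageDist`. -/
theorem lt_componentDist_iff {γ : ℝ} (hγ : 0 ≤ γ) {c : Code} {i k : ℕ} {q : ℝ} :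
    q < componentDist γ c i k ↔ q < γ ∧ (q < 0 ∨ ∃ w : ℕ × ℕ,
      Valid c w.1 w.2 ∧ i < w.1 ∧ k < w.1 ∧ q < (stageMatrix c w.2 w.1).entry i k) := by
  constructor
  · intro h
    refine ⟨h.trans_le (componentDist_le hγ c i k), ?_⟩
    obtain ⟨w, hw⟩ := exists_lt_of_lt_ciSup h
    unfold stageDist at hw
    split_ifs at hw with hv
    · exact Or.inr ⟨w, hv.1, hv.2.1, hv.2.2, hw.trans_le (min_le_right _ _)⟩
    · exact Or.inl hw
  · rintro ⟨h, h' | ⟨w, hv, hi, hk, hw⟩⟩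
    · exact h'.trans_le (componentDist_nonneg hγ c i k)
    · refine lt_of_lt_of_le ?_ (stageDist_le_componentDist hγ c i k w)
      rw [show w = (w.1, w.2) from rfl, stageDist_of_valid hv hi hk]
      exact lt_min h hw

theorem componentDist_self {γ : ℝ} (hγ : 0 ≤ γ) (c : Code) (i : ℕ) :
    componentDist γ c i i = 0 := by
  refine le_antisymm (ciSup_le fun w => ?_) (componentDist_nonneg hγ c i i)
  unfold stageDist
  split_ifs with h
  · rw [(h.1.isPseudo (by omega)).entry_self h.2.1]
    exact min_le_right _ _
  · exact le_rfl

theorem componentDist_comm (γ : ℝ) (c : Code) (i k : ℕ) :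
    componentDist γ c i k = componentDist γ c k i := by
  unfold componentDist
  congr 1
  funext w
  unfold stageDist
  by_cases h : Valid c w.1 w.2 ∧ i < w.1 ∧ k < w.1
  · rw [if_pos h, if_pos ⟨h.1, h.2.2, h.2.1⟩,
      (h.1.isPseudo (by omega)).entry_comm h.2.1 h.2.2]
  · rw [if_neg h, if_neg fun h' => h ⟨h'.1, h'.2.2, h'.2.1⟩]

/-- A matrix bounding the left side may not yet contain `j`. If `j` is confirmed, a larger valid
matrix contains all three points, and its entries dominate. The point `0` lies in every matrix
containing `i`. For an unconfirmed `j` both terms on the right would vanish, hence the hypothesis.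
-/
theorem componentDist_triangle {γ : ℝ} (hγ : 0 ≤ γ) {c : Code} {i j k : ℕ}
    (hj : j = 0 ∨ ∃ s, Valid c (j + 1) s) :
    componentDist γ c i k ≤ componentDist γ c i j + componentDist γ c j k := by
  refine ciSup_le fun w => ?_
  obtain ⟨n, s⟩ := w
  unfold stageDist
  split_ifs with h
  swap
  · exact add_nonneg (componentDist_nonneg hγ c i j) (componentDist_nonneg hγ c j k)
  obtain ⟨hv, hi, hk⟩ := h
  dsimp only at hv hi hk ⊢
  obtain ⟨m, t, hnm, hjm, hv'⟩ : ∃ m t, n ≤ m ∧ j < m ∧ Valid c m t := by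
    by_cases hjn : j < n
    · exact ⟨n, s, le_rfl, hjn, hv⟩
    · rcases hj with rfl | ⟨t, ht⟩
      · omega
      · exact ⟨j + 1, t, by omega, by omega, ht⟩
  have h1 := hv.entry_le_of_le hv' hnm hi hk
  have h2 := (hv'.isPseudo (by omega)).entry_triangle (hi.trans_le hnm) hjm (hk.trans_le hnm)
  have h3 := stageDist_le_componentDist hγ c i j (m, t)
  have h4 := stageDist_le_componentDist hγ c j k (m, t)
  rw [stageDist_of_valid hv' (hi.trans_le hnm) hjm] at h3
  rw [stageDist_of_valid hv' hjm (hk.trans_le hnm)] at h4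
  refine le_trans ?_ (add_le_add h3 h4)
  -- Capping preserves the triangle inequality: if either summand is capped, the sum is already at
  -- least `γ`.
  have a1 := RatMatrix.entry_nonneg (stageMatrix c t m) i j
  have a2 := RatMatrix.entry_nonneg (stageMatrix c t m) j k
  rcases min_cases γ ((stageMatrix c t m).entry i j) with ⟨e1, -⟩ | ⟨e1, -⟩ <;>
  rcases min_cases γ ((stageMatrix c t m).entry j k) with ⟨e2, -⟩ | ⟨e2, -⟩ <;>
  rw [e1, e2]
  · linarith [min_le_left γ ((stageMatrix c s n).entry i k)]
  · linarith [min_le_left γ ((stageMatrix c s n).entry i k)]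
  · linarith [min_le_left γ ((stageMatrix c s n).entry i k)]
  · linarith [min_le_right γ ((stageMatrix c s n).entry i k)]

/-! ### The universal pseudometric -/

/-- The program, the point and the stage coded by a natural number. -/
def decodePt (x : ℕ) : (Code × ℕ) × ℕ := Denumerable.ofNat ((Code × ℕ) × ℕ) x

open Classical in
/-- The point coded by `x` in its component, or `0` if this point is not yet known to exist. -/
noncomputable def ptIndex (x : ℕ) : ℕ :=
  if Valid (decodePt x).1.1 ((decodePt x).1.2 + 1) (decodePt x).2 then (decodePt x).1.2 else 0

theorem primrec_decodePt : Primrec decodePt := Primrec.ofNat _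

theorem primrec_ptIndex : Primrec ptIndex := by
  classical
  open Primrec in
  exact Primrec.ite (primrec_valid.comp
    (((fst.comp (fst.comp primrec_decodePt)).pair
      (succ.comp (snd.comp (fst.comp primrec_decodePt)))).pair (snd.comp primrec_decodePt)))
    (snd.comp (fst.comp primrec_decodePt)) (const 0)

theorem ptIndex_exists (x : ℕ) :
    ptIndex x = 0 ∨ ∃ s, Valid (decodePt x).1.1 (ptIndex x + 1) s := by
  unfold ptIndex
  split_ifs with h
  · exact Or.inr ⟨_, h⟩
  · exact Or.inl rfl

open Classical in
/-- The distance on the universal space: distinct components have distance `γ`. -/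
noncomputable def universalDist (γ : ℝ) (x y : ℕ) : ℝ :=
  if (decodePt x).1.1 = (decodePt y).1.1 then
    componentDist γ (decodePt x).1.1 (ptIndex x) (ptIndex y)
  else γ

theorem universalDist_nonneg {γ : ℝ} (hγ : 0 ≤ γ) (x y : ℕ) : 0 ≤ universalDist γ x y := by
  unfold universalDist
  split_ifs
  · exact componentDist_nonneg hγ _ _ _
  · exact hγ

theorem universalDist_le {γ : ℝ} (hγ : 0 ≤ γ) (x y : ℕ) : universalDist γ x y ≤ γ := by
  unfold universalDist
  split_ifs
  · exact componentDist_le hγ _ _ _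
  · exact le_rfl

/-- The pseudometric of the universal space. -/
noncomputable def universalPseudoMetric (γ : ℝ) (hγ : 0 ≤ γ) : NatPseudoMetric where
  d := universalDist γ
  self x := by rw [universalDist, if_pos rfl, componentDist_self hγ]
  comm x y := by
    by_cases h : (decodePt x).1.1 = (decodePt y).1.1
    · rw [universalDist, universalDist, if_pos h, if_pos h.symm, h, componentDist_comm]
    · rw [universalDist, universalDist, if_neg h, if_neg (Ne.symm h)]
  triangle x y z := by
    by_cases h : (decodePt x).1.1 = (decodePt y).1.1
    · by_cases h' : (decodePt y).1.1 = (decodePt z).1.1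
      · rw [universalDist, universalDist, universalDist, if_pos h, if_pos h', if_pos (h.trans h'),
          h]
        exact componentDist_triangle hγ (ptIndex_exists y)
      · have e : universalDist γ y z = γ := if_neg h'
        linarith [universalDist_le hγ x z, universalDist_nonneg hγ x y]
    · have e : universalDist γ x y = γ := if_neg h
      linarith [universalDist_le hγ x z, universalDist_nonneg hγ y z]

/-- The existential quantifier ranges over the whole disjunction, so that a single search over a
primitive recursive predicate remains besides `q < γ`. -/
theorem lt_universalDist_iff {γ : ℝ} (hγ : 0 ≤ γ) {x y : ℕ} {q : ℝ} :
    q < universalDist γ x y ↔ q < γ ∧ ∃ w : ℕ × ℕ, q < 0 ∨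
      ¬ (decodePt x).1.1 = (decodePt y).1.1 ∨
      (Valid (decodePt x).1.1 w.1 w.2 ∧ ptIndex x < w.1 ∧ ptIndex y < w.1 ∧
        q < (stageMatrix (decodePt x).1.1 w.2 w.1).entry (ptIndex x) (ptIndex y)) := by
  unfold universalDist
  split_ifs with h
  · simp [lt_componentDist_iff hγ, h, exists_or]
  · simp [h]

theorem codedRat_neg_iff {q : ℕ × ℕ × ℕ} : ((codedRat q : ℚ) : ℝ) < 0 ↔ q.1 < q.2.1 := by
  have h : codedRat q < 0 ↔ q.1 < q.2.1 := by
    unfold codedRat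
    rw [div_lt_iff₀ (by positivity), zero_mul, sub_neg]
    exact_mod_cast Iff.rfl
  rw [← h]
  exact_mod_cast Iff.rfl

theorem primrecPred_lt_stageMatrix {α : Type*} [Primcodable α] {c c' : α → Code}
    {i k n s : α → ℕ} {q : α → ℕ × ℕ × ℕ} (hc : Primrec c) (hc' : Primrec c') (hi : Primrec i)
    (hk : Primrec k) (hn : Primrec n) (hs : Primrec s) (hq : Primrec q) :
    PrimrecPred fun a => ((codedRat (q a) : ℚ) : ℝ) < 0 ∨ ¬ c a = c' a ∨
      (Valid (c a) (n a) (s a) ∧ i a < n a ∧ k a < n a ∧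
        ((codedRat (q a) : ℚ) : ℝ) < (stageMatrix (c a) (s a) (n a)).entry (i a) (k a)) := by
  open Primrec in
  have p1 : PrimrecPred fun a => ((codedRat (q a) : ℚ) : ℝ) < 0 :=
    (nat_lt.comp (fst.comp hq) (fst.comp (snd.comp hq))).of_eq fun z => codedRat_neg_iff.symm
  have p3 : PrimrecPred fun a => Valid (c a) (n a) (s a) :=
    primrec_valid.comp ((hc.pair hn).pair hs)
  have hm : Primrec fun a => stageMatrix (c a) (s a) (n a) :=
    primrec_stageMatrix.comp ((hs.pair hc).pair hn)
  have p6 : PrimrecPred fun a =>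
      ((codedRat (q a) : ℚ) : ℝ) < (stageMatrix (c a) (s a) (n a)).entry (i a) (k a) :=
    RatMatrix.primrec_codedRat_lt_entry.comp (hq.pair (hm.pair (hi.pair hk)))
  exact p1.or ((Primrec.eq.comp hc hc').not.or
    (p3.and ((nat_lt.comp hi hn).and ((nat_lt.comp hk hn).and p6))))

theorem uniformlyLeftCE_universalDist {γ : ℝ} (hγ : 0 ≤ γ) (h : IsLeftCE γ) :
    UniformlyLeftCE (universalDist γ) := by
  open Primrec in
  have hx : Primrec fun z : ((ℕ × ℕ) × ℕ × ℕ × ℕ) × ℕ × ℕ => z.1.1.1 :=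
    fst.comp (fst.comp fst)
  have hy : Primrec fun z : ((ℕ × ℕ) × ℕ × ℕ × ℕ) × ℕ × ℕ => z.1.1.2 :=
    snd.comp (fst.comp fst)
  have hr := rePred_exists (primrecPred_lt_stageMatrix
    (fst.comp (fst.comp (primrec_decodePt.comp hx)))
    (fst.comp (fst.comp (primrec_decodePt.comp hy)))
    (primrec_ptIndex.comp hx) (primrec_ptIndex.comp hy) (fst.comp snd) (snd.comp snd)
    (snd.comp fst))
  have hl : REPred fun z : (ℕ × ℕ) × ℕ × ℕ × ℕ => ((codedRat z.2 : ℚ) : ℝ) < γ :=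
    rePred_comp h Computable.snd
  refine (rePred_and hl hr).of_eq fun z => ?_
  rw [lt_universalDist_iff hγ]

/-! ### Universality -/

/-- Recursion where each step is an unbounded search that succeeds by an invariant. -/
theorem exists_computable_seq {σ : Type*} [Denumerable σ] {good : ℕ × σ → σ × ℕ → Prop}
    (hgood : PrimrecRel good) {inv : ℕ → σ → Prop} {a : σ} (ha : inv 0 a)
    (hex : ∀ n x, inv n x → ∃ w, good (n, x) w)
    (hinv : ∀ n x w, good (n, x) w → inv (n + 1) w.1) :
    ∃ g : ℕ → σ, Computable g ∧ ∀ n, inv n (g n) ∧ ∃ t, good (n, g n) (g (n + 1), t) := by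
  classical
  let dec : ℕ → σ × ℕ := Denumerable.ofNat (σ × ℕ)
  let step : ℕ × σ →. σ := fun x =>
    (Nat.rfind fun m => Part.some (decide (good x (dec m)))).map fun m => (dec m).1
  have hstep : Partrec step := by
    refine Partrec.map (Partrec.rfind ?_) ?_
    · exact (hgood.comp Primrec.fst
        ((Primrec.ofNat (σ × ℕ)).comp Primrec.snd)).decide.to_comp.partrec
    · exact (Primrec.fst.comp ((Primrec.ofNat (σ × ℕ)).comp Primrec.snd)).to_comp.to₂
  have hmem : ∀ n x, inv n x → ∃ y, y ∈ step (n, x) ∧ ∃ t, good (n, x) (y, t) := by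
    intro n x hx
    obtain ⟨w, hw⟩ := hex n x hx
    obtain ⟨m, hm, -⟩ := Nat.rfind_min' (p := fun m => decide (good (n, x) (dec m)))
      (m := Encodable.encode w) (by
        rw [show dec (Encodable.encode w) = w from Denumerable.ofNat_encode w]
        exact decide_eq_true hw)
    refine ⟨(dec m).1, Part.mem_map _ hm, (dec m).2, ?_⟩
    simpa using Nat.rfind_spec hm
  choose! next hnext hnext' using hmem
  let g : ℕ → σ := fun n => Nat.rec a (fun n x => next n x) n
  have hg : ∀ n, inv n (g n) := by
    intro n
    induction n with
    | zero => exact ha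
    | succ n ih =>
      obtain ⟨t, ht⟩ := hnext' n (g n) ih
      exact hinv n (g n) _ ht
  refine ⟨g, ?_, fun n => ⟨hg n, hnext' n (g n) (hg n)⟩⟩
  refine (Partrec.nat_rec (f := fun n : ℕ => n) (g := fun _ => Part.some a)
    (h := fun _ x => step x) Computable.id (Computable.const a).partrec
    (hstep.comp Computable.snd).to₂).of_eq_tot fun n => ?_
  induction n with
  | zero => exact Part.mem_some _
  | succ n ih => exact Part.mem_bind ih (hnext n (g n) (hg n))

/-- A left-c.e. pseudometric is the limit of an increasing computable sequence of rational
pseudometrics on the initial segments of the natural numbers. -/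
theorem NatPseudoMetric.exists_approximation (δ : NatPseudoMetric) (hδ : UniformlyLeftCE δ.d) :
    ∃ g : ℕ → RatMatrix, Computable g ∧ (∀ n, (g n).IsPseudo n) ∧
      (∀ n, RatMatrix.LE n (g n) (g (n + 1))) ∧
      (∀ n, ∀ i < n, ∀ k < n, (g n).entry i k ≤ δ.d i k) ∧
      ∀ (i k : ℕ) (x : ℝ), x < δ.d i k → ∃ n, i < n ∧ k < n ∧ x < (g n).entry i k := by
  obtain ⟨R, hR, hmono, hδR⟩ := REPred.exists_stages hδ
  obtain ⟨job, hjobp, hjobe⟩ : ∃ job : ℕ → ((ℕ × ℕ) × ℕ × ℕ × ℕ) × ℕ, Primrec job ∧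
      ∀ x, job (Encodable.encode x) = x :=
    ⟨Denumerable.ofNat _, Primrec.ofNat _, Denumerable.ofNat_encode⟩
  -- The stage `w.2` certifies each nonzero entry as strictly below `δ`. Zero entries are exempt,
  -- since a strict cut cannot certify `0` when the distance is `0`. The last clause serves one
  -- request: if the job's rational is already seen below the distance of two available points, the
  -- new entry must exceed it.
  let good : ℕ × RatMatrix → RatMatrix × ℕ → Prop := fun x w =>
    w.1.IsPseudo (x.1 + 1) ∧ RatMatrix.LE x.1 x.2 w.1 ∧
    (∀ i < x.1 + 1, ∀ k < x.1 + 1,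
      w.1.num i k = 0 ∨ R w.2 ((i, k), (w.1.num i k, 0, w.1.1))) ∧
    (¬ R (job x.1).2 (job x.1).1 ∨ ¬ (job x.1).1.1.1 < x.1 + 1 ∨ ¬ (job x.1).1.1.2 < x.1 + 1 ∨
      ((codedRat (job x.1).1.2 : ℚ) : ℝ) < w.1.entry (job x.1).1.1.1 (job x.1).1.1.2)
  let inv : ℕ → RatMatrix → Prop := fun n D => D.IsPseudo n ∧
    ∀ i < n, ∀ k < n, D.num i k = 0 ∨ D.entry i k < δ.d i k
  have hcoded : ∀ (D : RatMatrix) (i k : ℕ),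
      ((codedRat (D.num i k, 0, D.1) : ℚ) : ℝ) = D.entry i k := by
    intro D i k
    simp [codedRat, RatMatrix.entry]
  have hprim : PrimrecRel good := by
    open Primrec in
    have hj : Primrec fun x : (ℕ × RatMatrix) × RatMatrix × ℕ => job x.1.1 :=
      hjobp.comp (fst.comp fst)
    have hn : Primrec fun x : (ℕ × RatMatrix) × RatMatrix × ℕ => x.1.1 + 1 :=
      succ.comp (fst.comp fst)
    have hD : Primrec fun x : (ℕ × RatMatrix) × RatMatrix × ℕ => x.2.1 := fst.comp snd
    have hi : Primrec fun x : (ℕ × RatMatrix) × RatMatrix × ℕ => (job x.1.1).1.1.1 :=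
      fst.comp (fst.comp (fst.comp hj))
    have hk : Primrec fun x : (ℕ × RatMatrix) × RatMatrix × ℕ => (job x.1.1).1.1.2 :=
      snd.comp (fst.comp (fst.comp hj))
    have hnum : Primrec fun x : (((ℕ × RatMatrix) × RatMatrix × ℕ) × ℕ) × ℕ =>
        x.1.1.2.1.num x.1.2 x.2 :=
      RatMatrix.primrec_num_comp (hD.comp (fst.comp fst)) (snd.comp fst) snd
    have q1 : PrimrecPred fun x : (((ℕ × RatMatrix) × RatMatrix × ℕ) × ℕ) × ℕ =>
        x.1.1.2.1.num x.1.2 x.2 = 0 ∨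
          R x.1.1.2.2 ((x.1.2, x.2), (x.1.1.2.1.num x.1.2 x.2, 0, x.1.1.2.1.1)) :=
      (Primrec.eq.comp hnum (const 0)).or (hR.comp (snd.comp (snd.comp (fst.comp fst)))
        (((snd.comp fst).pair snd).pair (hnum.pair
          ((const 0).pair (fst.comp (hD.comp (fst.comp fst)))))))
    have q2 := primrecPred_forall_lt (primrecPred_forall_lt q1 (hn.comp fst)) hn
    have q3 : PrimrecPred fun x : (ℕ × RatMatrix) × RatMatrix × ℕ => x.2.1.IsPseudo (x.1.1 + 1) :=
      RatMatrix.primrec_isPseudo.comp hn hD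
    have q4 : PrimrecPred fun x : (ℕ × RatMatrix) × RatMatrix × ℕ =>
        RatMatrix.LE x.1.1 x.1.2 x.2.1 :=
      RatMatrix.primrec_le.comp ((fst.comp fst).pair ((snd.comp fst).pair hD))
    have q5 : PrimrecPred fun x : (ℕ × RatMatrix) × RatMatrix × ℕ =>
        R (job x.1.1).2 (job x.1.1).1 := hR.comp (snd.comp hj) (fst.comp hj)
    have q6 : PrimrecPred fun x : (ℕ × RatMatrix) × RatMatrix × ℕ =>
        ((codedRat (job x.1.1).1.2 : ℚ) : ℝ) < x.2.1.entry (job x.1.1).1.1.1 (job x.1.1).1.1.2 :=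
      RatMatrix.primrec_codedRat_lt_entry.comp ((snd.comp (fst.comp hj)).pair
        (hD.pair (hi.pair hk)))
    exact q3.and (q4.and (q2.and
      (q5.not.or ((nat_lt.comp hi hn).not.or ((nat_lt.comp hk hn).not.or q6)))))
  have hex : ∀ n x, inv n x → ∃ w, good (n, x) w := by
    classical
    rintro n x ⟨-, hx⟩
    let z := job n
    -- `b1` forces growth over the previous matrix and `b2` serves the request. The midpoint in `b2`
    -- turns the weak bound for `D` into a strict inequality over the requested rational; the value
    -- `0` imposes no constraint.
    let b1 : ℕ → ℕ → ℝ := fun i k => if i < n ∧ k < n then x.entry i k else 0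
    let b2 : ℕ → ℕ → ℝ := fun i k =>
      if R z.2 z.1 ∧ z.1.1 = (i, k) then (((codedRat z.1.2 : ℚ) : ℝ) + δ.d i k) / 2 else 0
    have hb1 : ∀ i k, b1 i k ≤ 0 ∨ b1 i k < δ.d i k := by
      intro i k
      simp only [b1]
      split_ifs with h
      · rcases hx i h.1 k h.2 with h' | h'
        · left
          simp [RatMatrix.entry, h']
        · exact Or.inr h'
      · exact Or.inl le_rfl
    have hlt : ∀ i k, R z.2 z.1 → z.1.1 = (i, k) → ((codedRat z.1.2 : ℚ) : ℝ) < δ.d i k := by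
      intro i k h1 h2
      have := (hδR z.1).2 ⟨_, h1⟩
      rwa [h2] at this
    have hb2 : ∀ i k, b2 i k ≤ 0 ∨ b2 i k < δ.d i k := by
      intro i k
      simp only [b2]
      split_ifs with h
      · right
        linarith [hlt i k h.1 h.2]
      · exact Or.inl le_rfl
    have hb : ∀ i k, max (b1 i k) (b2 i k) ≤ 0 ∨ max (b1 i k) (b2 i k) < δ.d i k := by
      intro i k
      rcases max_choice (b1 i k) (b2 i k) with h | h <;> rw [h]
      · exact hb1 i k
      · exact hb2 i k
    obtain ⟨D, hD, hDδ, hbD⟩ := exists_ratMatrix_between δ.self δ.comm δ.triangle hb (n + 1)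
    have ht : ∀ᶠ t : ℕ in Filter.atTop, ∀ i ∈ Set.Iio (n + 1), ∀ k ∈ Set.Iio (n + 1),
        D.num i k = 0 ∨ R t ((i, k), (D.num i k, 0, D.1)) := by
      rw [Filter.eventually_all_finite (Set.finite_Iio _)]
      intro i hi
      rw [Filter.eventually_all_finite (Set.finite_Iio _)]
      intro k hk
      rcases hDδ i hi k hk with h | h
      · exact Filter.Eventually.of_forall fun _ => Or.inl h
      · obtain ⟨t, ht⟩ := (hδR ((i, k), (D.num i k, 0, D.1))).1 (by
          rw [hcoded]
          exact h)
        filter_upwards [Filter.eventually_ge_atTop t] with s hs using Or.inr (hmono t s _ hs ht)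
    obtain ⟨t, ht⟩ := ht.exists
    refine ⟨(D, t), hD, fun i hi k hk => ?_, ht, ?_⟩
    · rw [← RatMatrix.entry_le_entry_iff]
      refine le_trans ?_ (hbD i (by omega) k (by omega))
      exact le_max_of_le_left (if_pos ⟨hi, hk⟩).ge
    · by_cases h1 : R z.2 z.1
      swap
      · exact Or.inl h1
      by_cases h2 : z.1.1.1 < n + 1
      swap
      · exact Or.inr (Or.inl h2)
      by_cases h3 : z.1.1.2 < n + 1
      swap
      · exact Or.inr (Or.inr (Or.inl h3))
      refine Or.inr (Or.inr (Or.inr ?_))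
      refine lt_of_lt_of_le ?_ (hbD _ h2 _ h3)
      refine lt_max_of_lt_right ?_
      have h4 : b2 z.1.1.1 z.1.1.2 = (((codedRat z.1.2 : ℚ) : ℝ) + δ.d z.1.1.1 z.1.1.2) / 2 :=
        if_pos ⟨h1, rfl⟩
      rw [h4]
      have h5 := hlt z.1.1.1 z.1.1.2 h1 rfl
      change ((codedRat z.1.2 : ℚ) : ℝ) < _
      linarith
  have hinv : ∀ n x w, good (n, x) w → inv (n + 1) w.1 := by
    rintro n x w ⟨h1, -, h3, -⟩
    refine ⟨h1, fun i hi k hk => (h3 i hi k hk).imp_right fun h => ?_⟩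
    have := (hδR _).2 ⟨_, h⟩
    rwa [hcoded] at this
  obtain ⟨g, hg, hgood⟩ := exists_computable_seq hprim (inv := inv) (a := (0, []))
    ⟨fun i hi => absurd hi (Nat.not_lt_zero i), fun i hi => absurd hi (Nat.not_lt_zero i)⟩ hex hinv
  refine ⟨g, hg, fun n => (hgood n).1.1, fun n => ?_, fun n i hi k hk => ?_, fun i k x hx => ?_⟩
  · obtain ⟨t, ht⟩ := (hgood n).2
    exact ht.2.1
  · rcases (hgood n).1.2 i hi k hk with h | h
    · have h0 : (g n).entry i k = 0 := by simp [RatMatrix.entry, h]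
      rw [h0]
      have := δ.triangle i k i
      rw [δ.self, δ.comm k i] at this
      linarith
    · exact h.le
  · obtain ⟨q, hxq, hqδ⟩ := exists_rat_btwn hx
    obtain ⟨r, rfl⟩ : ∃ r, codedRat r = q := by
      -- The numerator is split into positive and negative parts; `codedRat` adds one to the last
      -- component.
      refine ⟨(q.num.toNat, (-q.num).toNat, q.den - 1), ?_⟩
      have h1 : ((q.num.toNat : ℕ) : ℚ) - (((-q.num).toNat : ℕ) : ℚ) = q.num := by
        exact_mod_cast Int.toNat_sub_toNat_neg q.num
      have h2 : (((q.den - 1 : ℕ) : ℚ) + 1) = q.den := by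
        exact_mod_cast Nat.sub_add_cancel q.den_pos
      unfold codedRat
      dsimp only
      rw [h1, h2, Rat.num_div_den]
    obtain ⟨t, ht⟩ := (hδR ((i, k), r)).1 hqδ
    -- Raising the stage to at least `i` and `k` makes the job number `n` at least as large as both,
    -- so the points are available in the matrix `g (n + 1)`.
    let T := max t (max i k)
    let n := Encodable.encode ((((i, k), r), T) : ((ℕ × ℕ) × ℕ × ℕ × ℕ) × ℕ)
    have hjob : job n = (((i, k), r), T) := hjobe _
    have hTn : T ≤ n := Nat.right_le_pair _ _
    have hi : i ≤ T := (le_max_left i k).trans (le_max_right _ _)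
    have hk : k ≤ T := (le_max_right i k).trans (le_max_right _ _)
    obtain ⟨s, -, -, -, hs⟩ := (hgood n).2
    dsimp only at hs
    rw [hjob] at hs
    dsimp only at hs
    refine ⟨n + 1, by omega, by omega, hxq.trans ?_⟩
    rcases hs with h | h | h | h
    · exact absurd (hmono t T _ (le_max_left _ _) ht) h
    · omega
    · omega
    · exact h

/-- Every left-c.e. pseudometric bounded by `γ` is a component of the universal pseudometric. -/
theorem NatPseudoMetric.exists_universalDist_eq (δ : NatPseudoMetric) (hδ : UniformlyLeftCE δ.d)
    {γ : ℝ} (hγ : 0 ≤ γ) (hle : ∀ i k, δ.d i k ≤ γ) :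
    ∃ f : ℕ → ℕ, Computable f ∧ ∀ i k, universalDist γ (f i) (f k) = δ.d i k := by
  classical
  obtain ⟨g, hg, hps, hLE, hgδ, hlim⟩ := δ.exists_approximation hδ
  obtain ⟨c, hc⟩ := Nat.Partrec.Code.exists_code.1
    (Partrec.nat_iff.1 (Computable.encode.comp hg).partrec)
  have hmem : ∀ n, Encodable.encode (g n) ∈ eval c n := fun n => by
    rw [hc]
    exact Part.mem_some _
  have hmat : ∀ s n, (evaln s c n).isSome = true → stageMatrix c s n = g n := fun s n h => by
    rw [stageMatrix_eq (hmem n) h, Denumerable.ofNat_encode]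
  have hconv : ∀ n, ∀ᶠ s : ℕ in Filter.atTop, (evaln s c n).isSome = true := by
    intro n
    obtain ⟨s, hs⟩ := Nat.Partrec.Code.evaln_complete.1 (hmem n)
    filter_upwards [Filter.eventually_ge_atTop s] with t ht
    exact Option.isSome_iff_exists.2 ⟨_, Nat.Partrec.Code.evaln_mono ht hs⟩
  have hvalid : ∀ n, ∃ s, Valid c n s := by
    intro n
    have : ∀ᶠ s : ℕ in Filter.atTop, ∀ m ∈ Set.Iio n,
        (evaln s c m).isSome = true ∧ (evaln s c (m + 1)).isSome = true := by
      rw [Filter.eventually_all_finite (Set.finite_Iio _)]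
      exact fun m _ => (hconv m).and (hconv (m + 1))
    obtain ⟨s, hs⟩ := this.exists
    refine ⟨s, fun m hm => ⟨(hs m hm).1, (hs m hm).2, ?_⟩⟩
    rw [hmat s m (hs m hm).1, hmat s (m + 1) (hs m hm).2]
    exact ⟨hps _, hLE m⟩
  -- Every valid matrix of `c` is some `g n`, and the cap is harmless because `δ` is bounded by `γ`.
  have hdist : ∀ i k, componentDist γ c i k = δ.d i k := by
    intro i k
    refine eq_of_forall_lt_iff fun x => ?_
    rw [lt_componentDist_iff hγ]
    constructor
    · rintro ⟨-, h | ⟨w, hv, hi, hk, hw⟩⟩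
      · have := δ.triangle i k i
        rw [δ.self, δ.comm k i] at this
        linarith
      · rw [hmat _ _ (hv.isSome (by omega))] at hw
        exact hw.trans_le (hgδ _ i hi k hk)
    · intro h
      refine ⟨h.trans_le (hle i k), Or.inr ?_⟩
      obtain ⟨n, hi, hk, hx⟩ := hlim i k x h
      obtain ⟨s, hs⟩ := hvalid n
      refine ⟨(n, s), hs, hi, hk, ?_⟩
      rw [hmat _ _ (hs.isSome (by omega))]
      exact hx
  have hcomp : Computable fun i => Nat.find (hvalid (i + 1)) :=
    Computable.find (P := fun i s => Valid c (i + 1) s)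
      (primrec_valid.comp (((Primrec.const c).pair (Primrec.succ.comp Primrec.fst)).pair
        Primrec.snd)).decide.to_comp.computablePred fun i => hvalid (i + 1)
  -- The code includes a stage confirming the point `i`, so `ptIndex` does not collapse it to `0`.
  let f : ℕ → ℕ := fun i =>
    Encodable.encode (((c, i), Nat.find (hvalid (i + 1))) : (Code × ℕ) × ℕ)
  have hdec : ∀ i, decodePt (f i) = ((c, i), Nat.find (hvalid (i + 1))) := fun i =>
    Denumerable.ofNat_encode _
  have hidx : ∀ i, ptIndex (f i) = i := by
    intro i
    rw [ptIndex, hdec, if_pos (Nat.find_spec (hvalid (i + 1)))]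
  refine ⟨f, Computable.encode.comp
    (((Computable.const c).pair Computable.id).pair hcomp), fun i k => ?_⟩
  rw [universalDist, hdec, hdec, if_pos rfl, hidx, hidx, hdist]

/-- The universal space of diameter at most `γ`. -/
noncomputable def universalSpace (γ : ℝ) (hγ : 0 ≤ γ) (h : IsLeftCE γ) : MetricSp.{0} :=
  (universalPseudoMetric γ hγ).toMetricSp (uniformlyLeftCE_universalDist hγ h)

theorem dist_universalSpace_point {γ : ℝ} (hγ : 0 ≤ γ) (h : IsLeftCE γ) (i k : ℕ) :
    dist ((universalSpace γ hγ h).point i) ((universalSpace γ hγ h).point k) =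
      universalDist γ i k :=
  NatPseudoMetric.dist_point _ _ i k

theorem isUniversalSpace_universalSpace {γ : ℝ} (hγ : 0 ≤ γ) (h : IsLeftCE γ) :
    IsUniversalSpace.{u, 0} γ (universalSpace γ hγ h) := by
  refine ⟨MetricSp.diamLE_of_point fun i k => ?_, fun M hM => ?_⟩
  · rw [dist_universalSpace_point]
    exact universalDist_le hγ i k
  · obtain ⟨f, hf, hfd⟩ := M.natPseudoMetric.exists_universalDist_eq M.leftCE hγ fun i k => hM _ _
    refine exists_isComputableEmbedding hf fun i k => ?_
    rw [dist_universalSpace_point, hfd]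
    rfl

/-! ### Diameter one and `Π⁰₁` equivalence relations -/

theorem isLeftCE_one : IsLeftCE 1 := by
  have h : PrimrecPred fun t : ℕ × ℕ × ℕ => t.1 < t.2.2 + 1 + t.2.1 := by
    open Primrec in
    exact nat_lt.comp fst (nat_add.comp (succ.comp (snd.comp snd)) (fst.comp snd))
  refine (h.decide.to_comp.computablePred.to_re).of_eq fun t => ?_
  have h1 : codedRat t < 1 ↔ t.1 < t.2.2 + 1 + t.2.1 := by
    unfold codedRat
    rw [div_lt_iff₀ (by positivity), one_mul, sub_lt_iff_lt_add]
    exact_mod_cast Iff.rfl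
  rw [← h1]
  exact_mod_cast Iff.rfl

open Classical in
/-- The discrete pseudometric given by an equivalence relation. -/
noncomputable def discretePseudoMetric {F : ℕ → ℕ → Prop} (hF : Equivalence F) :
    NatPseudoMetric where
  d i k := if F i k then 0 else 1
  self i := if_pos (hF.refl i)
  comm i k := by simp only [show F i k ↔ F k i from ⟨hF.symm, hF.symm⟩]
  triangle i j k := by
    by_cases h1 : F i j <;> by_cases h2 : F j k
    · simp [h1, h2, hF.trans h1 h2]
    all_goals
      simp only [h1, h2, if_true, if_false]
      split_ifs <;> norm_num

/-- A rational `q` lies below the distance exactly when `q < 1` and either `q < 0` or the two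
indices are inequivalent; the latter is c.e. -/
theorem uniformlyLeftCE_discretePseudoMetric {F : ℕ → ℕ → Prop} (hF : IsPi01Equivalence F) :
    UniformlyLeftCE (discretePseudoMetric hF.1).d := by
  obtain ⟨R, hR, -, hFR⟩ := REPred.exists_stages hF.2
  open Primrec in
  have h1 : PrimrecPred fun z : ((ℕ × ℕ) × ℕ × ℕ × ℕ) × ℕ => z.1.2.1 < z.1.2.2.1 ∨ R z.2 z.1.1 :=
    (nat_lt.comp (fst.comp (snd.comp fst)) (fst.comp (snd.comp (snd.comp fst)))).or
      (hR.comp snd (fst.comp fst))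
  have h2 : REPred fun z : (ℕ × ℕ) × ℕ × ℕ × ℕ => ((codedRat z.2 : ℚ) : ℝ) < 1 :=
    rePred_comp isLeftCE_one Computable.snd
  refine (rePred_and h2 (rePred_exists h1)).of_eq fun z => ?_
  simp only [discretePseudoMetric, exists_or, exists_const, ← hFR, ← codedRat_neg_iff]
  by_cases h : F z.1.1 z.1.2
  · simp only [h, not_true_eq_false, or_false, if_true]
    exact ⟨fun h => h.2, fun h => ⟨h.trans one_pos, h⟩⟩
  · simp [h]

/-- Nonzero distance means `0 < d`, which is c.e. from the left cuts. For universality, the map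
embedding the discrete pseudometric of `F` is the reduction. -/
theorem isUniversalPi01Equivalence_universalDist_one :
    IsUniversalPi01Equivalence fun i k => universalDist 1 i k = 0 := by
  let U := universalPseudoMetric 1 zero_le_one
  have hU := uniformlyLeftCE_universalDist zero_le_one isLeftCE_one
  refine ⟨⟨⟨U.self, fun {i k} h => (U.comm k i).trans h, fun {i j k} h1 h2 =>
    le_antisymm ((U.triangle i j k).trans ?_) (universalDist_nonneg zero_le_one i k)⟩, ?_⟩,
    fun F hF => ?_⟩
  · change universalDist 1 i j + universalDist 1 j k ≤ 0
    rw [h1, h2, add_zero]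
  · refine (rePred_comp hU (Computable.id.pair (Computable.const (0, 0, 0)))).of_eq fun x => ?_
    have h0 : codedRat (0, 0, 0) = 0 := by simp [codedRat]
    simp only [id, h0, Rat.cast_zero]
    exact (universalDist_nonneg zero_le_one x.1 x.2).lt_iff_ne'
  · obtain ⟨f, hf, hfd⟩ := (discretePseudoMetric hF.1).exists_universalDist_eq
      (uniformlyLeftCE_discretePseudoMetric hF) (zero_le_one (α := ℝ)) fun i k => by
        simp only [discretePseudoMetric]
        split_ifs <;> norm_num
    refine ⟨f, hf, fun i k => ?_⟩
    simp only [hfd, discretePseudoMetric]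
    by_cases h : F i k <;> simp [h]

end LeftCE

theorem mainTheorem7 :
    (∀ γ : ℝ, 0 < γ → LeftCE.IsLeftCE γ →
      ∃ U : LeftCE.MetricSp.{0}, LeftCE.IsUniversalSpace.{u, 0} γ U) ∧
    (∃ U : LeftCE.MetricSp.{0}, LeftCE.IsUniversalSpace.{u, 0} 1 U ∧
      LeftCE.IsUniversalPi01Equivalence
        (fun i k => dist (U.point i) (U.point k) = 0)) := by
  refine ⟨fun γ hγ h => ⟨_, LeftCE.isUniversalSpace_universalSpace hγ.le h⟩,
    LeftCE.universalSpace 1 zero_le_one LeftCE.isLeftCE_one,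
    LeftCE.isUniversalSpace_universalSpace _ _, ?_⟩
  simp only [LeftCE.dist_universalSpace_point]
  exact LeftCE.isUniversalPi01Equivalence_universalDist_one
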